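/- **Corollary 3.6.** Let $\mathcal A$ be a unital C*-algebra. An *operator $\mathcal A$-system* is an operator system $\mathcal S$ with unit $e_{\mathcal S}$ and positive cones $M_n(\mathcal S)^+$ (a complex $*$-vector space with a matrix ordering and an Archimedean matrix order unit), together with an $\mathcal A$-bimodule structure such that $(a\cdot s)^*=s^*\cdot a^*$ and $a\cdot e_{\mathcal S}=e_{\mathcal S}\cdot a$ for all $a\in\mathcal A$, $s\in\mathcal S$, and $[a_{ij}]\cdot[s_{ij}]\cdot[a_{ij}]^*\in M_n(\mathcal S)^+$ for all $[a_{ij}]\in M_{n,m}(\mathcal A)$, $[s_{ij}]\in M_m(\mathcal S)^+$. It is *faithful* if $a\cdot e_{\mathcal S}\ne 0$ for every $a\neq 0$ in $\mathcal A$. Morphisms of operator $\mathcal A$-systems are the unital completely positive $\mathcal A$-bimodule maps. Let $\mathcal S$ and $\mathcal T$ be faithful operator $\mathcal A$-systems. Then they have a coproduct $\mathcal S\oplus_{\mathcal A}\mathcal T$ in the category of operator $\mathcal A$-systems. For every such coproduct, with canonical morphisms $i_1:\mathcal S\to\mathcal S\oplus_{\mathcal A}\mathcal T$ and $i_2:\mathcal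 T\to\mathcal S\oplus_{\mathcal A}\mathcal T$ and unit $e$, the following hold: 1. $\mathcal S\oplus_{\mathcal A}\mathcal T$ is faithful, and $i_1$ and $i_2$ are complete order embeddings; 2. $i_1(a\cdot e_{\mathcal S})=a\cdot e=i_2(a\cdot e_{\mathcal T})$ for all $a\in\mathcal A$; 3. the map $j:\mathcal A\to\mathcal S\oplus_{\mathcal A}\mathcal T$, $j(a)=a\cdot e$, is a complete order embedding, where $M_n(\mathcal A)$ carries its C*-algebra order; 4. $i_1(\mathcal S)\cap i_2(\mathcal T)=j(\mathcal A)$. That is, $i_1(\mathcal S)\cap i_2(\mathcal T)=\mathcal A$ completely order isomorphically: $\mathcal S$, $\mathcal T$ and $\mathcal A$ may be regarded as subsystems of $\mathcal S\oplus_{\mathcal A}\mathcal T$ with $\mathcal S\cap\mathcal T=\mathcal A$. -/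

import Mathlib

open scoped Matrix
open MulOpposite

universe u v w p

/-- An abstract operator system: a complex *-vector space `V` with a matrix ordering `cone` and an
Archimedean matrix order unit `unit`. -/
class OperatorSystem (V : Type u) extends
    AddCommGroup V, StarAddMonoid V, Module ℂ V, StarModule ℂ V where
  /-- the Archimedean matrix order unit `e` -/
  unit : V
  /-- the positive elements `M_n(V)⁺` -/
  cone : (n : ℕ) → Set (Matrix (Fin n) (Fin n) V)
  star_unit : star unit = unit
  cone_hermitian : ∀ n, ∀ x ∈ cone n, xᴴ = x
  cone_nonempty : ∀ n, (cone n).Nonempty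
  cone_add : ∀ n, ∀ x ∈ cone n, ∀ y ∈ cone n, x + y ∈ cone n
  cone_smul : ∀ n, ∀ r : ℝ, 0 ≤ r → ∀ x ∈ cone n, (r : ℂ) • x ∈ cone n
  cone_proper : ∀ n, ∀ x ∈ cone n, -x ∈ cone n → x = 0
  /-- `X C_n X* ⊆ C_m` for scalar `m × n` matrices `X` -/
  cone_compatible : ∀ (n m : ℕ) (X : Matrix (Fin m) (Fin n) ℂ), ∀ x ∈ cone n,
    Matrix.of (fun i j => ∑ k, ∑ l, (X i k * starRingEnd ℂ (X j l)) • x k l) ∈ cone m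
  /-- `e_n = diag(e, …, e)` is an order unit of `M_n(V)` -/
  order_unit : ∀ n, ∀ x : Matrix (Fin n) (Fin n) V, xᴴ = x →
    ∃ r : ℝ, 0 < r ∧ (r : ℂ) • Matrix.diagonal (fun _ => unit) - x ∈ cone n
  /-- `e_n` is Archimedean -/
  archimedean : ∀ n, ∀ x : Matrix (Fin n) (Fin n) V, xᴴ = x →
    (∀ r : ℝ, 0 < r → (r : ℂ) • Matrix.diagonal (fun _ => unit) + x ∈ cone n) → x ∈ cone n

namespace OperatorSystem

/-- Completely positive maps, with respect to families of matrix cones `C` on `V`, `D` on `W`. -/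
def IsCompletelyPositive {V : Type u} {W : Type v} [AddCommGroup V] [Module ℂ V]
    [AddCommGroup W] [Module ℂ W] (C : (n : ℕ) → Set (Matrix (Fin n) (Fin n) V))
    (D : (n : ℕ) → Set (Matrix (Fin n) (Fin n) W)) (φ : V →ₗ[ℂ] W) : Prop :=
  ∀ n, ∀ x ∈ C n, x.map φ ∈ D n

/-- Complete order embeddings: `φ` is a bijection onto its range such that both `φ` and
`φ⁻¹ : φ(V) → V` are completely positive, where `M_n(φ(V))` carries the cone
`M_n(φ(V)) ∩ D n`. -/
def IsCompleteOrderEmbedding {V : Type u} {W : Type v} [AddCommGroup V] [Module ℂ V]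
    [AddCommGroup W] [Module ℂ W] (C : (n : ℕ) → Set (Matrix (Fin n) (Fin n) V))
    (D : (n : ℕ) → Set (Matrix (Fin n) (Fin n) W)) (φ : V →ₗ[ℂ] W) : Prop :=
  Function.Injective φ ∧ ∀ n, ∀ x : Matrix (Fin n) (Fin n) V, x ∈ C n ↔ x.map φ ∈ D n

/-- The positive elements of the C*-algebra `M_n(A)`, i.e. the matrices of the form `b* b`. -/
def cstarCone (A : Type u) [CStarAlgebra A] (n : ℕ) : Set (Matrix (Fin n) (Fin n) A) :=
  {x | ∃ b : Matrix (Fin n) (Fin n) A, x = bᴴ * b}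

end OperatorSystem

/-- The left action `[a_{ij}] · [x_{ij}] = [∑ₖ a_{ik} · x_{kj}]` of matrices over `A`. -/
def matrixLeftAct {A : Type u} {S : Type v} [SMul A S] [AddCommMonoid S] {n m l : ℕ}
    (a : Matrix (Fin n) (Fin m) A) (x : Matrix (Fin m) (Fin l) S) : Matrix (Fin n) (Fin l) S :=
  Matrix.of fun i j => ∑ k, a i k • x k j

/-- The right action `[x_{ij}] · [b_{ij}] = [∑ₖ x_{ik} · b_{kj}]`; a right action of `A` on `S`
is, as usual in Mathlib, an action `op b • x = x · b` of the opposite algebra. -/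
def matrixRightAct {A : Type u} {S : Type v} [SMul Aᵐᵒᵖ S] [AddCommMonoid S] {n m l : ℕ}
    (x : Matrix (Fin n) (Fin m) S) (b : Matrix (Fin m) (Fin l) A) : Matrix (Fin n) (Fin l) S :=
  Matrix.of fun i j => ∑ k, op (b k j) • x i k

/-- Operator `A`-systems over a unital C*-algebra `A`: operator systems `S` that are
`A`-bimodules (left action `a • s`, right action `op a • s`, both bilinear over `ℂ`) with
`(a · s)* = s* · a*`, `a · e = e · a` and `A`-compatible matrix cones. -/
class OperatorASystem (A : Type u) (S : Type v) [CStarAlgebra A] [OperatorSystem S]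
    [Module A S] [Module Aᵐᵒᵖ S] : Prop extends
    SMulCommClass A Aᵐᵒᵖ S, IsScalarTower ℂ A S where
  isScalarTower_op : IsScalarTower ℂ Aᵐᵒᵖ S
  star_smul : ∀ (a : A) (s : S), star (a • s) = op (star a) • star s
  smul_unit : ∀ a : A, a • (OperatorSystem.unit : S) = op a • (OperatorSystem.unit : S)
  cone_compatible : ∀ (n m : ℕ) (a : Matrix (Fin n) (Fin m) A),
    ∀ s ∈ (OperatorSystem.cone m : Set (Matrix (Fin m) (Fin m) S)),
      matrixRightAct (matrixLeftAct a s) aᴴ ∈ OperatorSystem.cone n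

namespace OperatorASystem

open OperatorSystem

/-- An operator `A`-system is faithful if `a · e ≠ 0` for all `a ≠ 0`. -/
def IsFaithful (A : Type u) (S : Type v) [CStarAlgebra A] [OperatorSystem S]
    [Module A S] [Module Aᵐᵒᵖ S] : Prop :=
  ∀ a : A, a ≠ 0 → a • (unit : S) ≠ 0

/-- The canonical linear map `a ↦ a · e` from `A` to an operator `A`-system. -/
def ofAlgebra (A : Type u) (S : Type v) [CStarAlgebra A] [OperatorSystem S]
    [Module A S] [Module Aᵐᵒᵖ S] [OperatorASystem A S] : A →ₗ[ℂ] S where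
  toFun a := a • (unit : S)
  map_add' a b := add_smul a b _
  map_smul' z a := smul_assoc z a _

/-- The morphisms of operator `A`-systems: unital completely positive `A`-bimodule maps. -/
structure IsMorphism (A : Type u) {S : Type v} {T : Type w} [CStarAlgebra A]
    [OperatorSystem S] [Module A S] [Module Aᵐᵒᵖ S]
    [OperatorSystem T] [Module A T] [Module Aᵐᵒᵖ T] (φ : S →ₗ[ℂ] T) : Prop where
  unital : φ unit = unit
  completelyPositive : IsCompletelyPositive cone cone φ
  bimodule : ∀ (a b : A) (s : S), φ (op b • (a • s)) = op b • (a • φ s)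

/-- `P` with `i₁ : S → P`, `i₂ : T → P` is a coproduct of `S` and `T` in the category of operator
`A`-systems and unital completely positive `A`-bimodule maps. -/
structure IsCoproduct (A : Type u) {S : Type v} {T : Type w} {P : Type p} [CStarAlgebra A]
    [OperatorSystem S] [Module A S] [Module Aᵐᵒᵖ S]
    [OperatorSystem T] [Module A T] [Module Aᵐᵒᵖ T]
    [OperatorSystem P] [Module A P] [Module Aᵐᵒᵖ P]
    (i₁ : S →ₗ[ℂ] P) (i₂ : T →ₗ[ℂ] P) : Prop where
  morphism_left : IsMorphism A i₁
  morphism_right : IsMorphism A i₂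
  universal : ∀ (R : Type p) [OperatorSystem R] [Module A R] [Module Aᵐᵒᵖ R]
    [OperatorASystem A R] (ψ₁ : S →ₗ[ℂ] R) (ψ₂ : T →ₗ[ℂ] R),
    IsMorphism A ψ₁ → IsMorphism A ψ₂ →
      ∃! Ψ : P →ₗ[ℂ] R, IsMorphism A Ψ ∧ Ψ ∘ₗ i₁ = ψ₁ ∧ Ψ ∘ₗ i₂ = ψ₂

end OperatorASystem

/-! The coproduct is built by hand as the vector space quotient of `S × T` by the pairs `(a · e, -a
· e)`. Its cones are the sums `s + t` of positive matrices, closed up in the Archimedean sense. A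
map out of it is a pair of maps agreeing on `A`, which morphisms always do, so the universal
property is immediate once this object is known to be an operator `A`-system.

Faithfulness enters through `IsFaithful.mem_cstarCone`: in a faithful system the order on `A · e` is
exactly the C*-order. A decomposition `s + t` is unique up to moving a matrix over `A` from one
summand to the other (`Amalgam.comb_eq_comb_iff`), so a positivity statement about `A` obtained in
one system can be used in the other. This shows that `S` and `T` sit inside with their own orders.

The main difficulty is `Amalgam.archCone_proper`: the Archimedean closure must be proper without a
further quotient. If `x` and `-x` both lie in it, the corrections `a r` over `A` at level `r` are
norm Cauchy as `r → 0`, and completeness of `M_n(A)` gives one correction that kills `x`.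

An arbitrary coproduct maps to this model compatibly with the inclusions, so injectivity and order
reflection pull back to it. -/

section CStarOrder

/-! ### Two facts about the order of a C*-algebra. -/

variable {B : Type*} [CStarAlgebra B]

/-- Take `c = a⁻`: the compression is `-(a⁻)³`, which vanishes only if `a⁻ = 0`. Positivity is
phrased through `star b * b`, so that no order instance occurs in the statement. -/
theorem exists_conjugate_eq_neg_star_mul_self {a : B} (ha : IsSelfAdjoint a) :
    ∃ c d : B, c * a * star c = -(star d * d) ∧ (star d * d = 0 → ∃ b, a = star b * b) := by
  let _ := CStarAlgebra.spectralOrder B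
  have := CStarAlgebra.spectralOrderedRing B
  have hc : IsSelfAdjoint a⁻ := .of_nonneg (CFC.negPart_nonneg a)
  have hca : a⁻ * a = -(a⁻ * a⁻) := by
    have := congrArg (a⁻ * ·) (CFC.posPart_sub_negPart a ha)
    simpa [mul_sub] using this.symm
  have hnn : 0 ≤ a⁻ * a⁻ * a⁻ := by
    simpa [hc.star_eq] using star_right_conjugate_nonneg (CFC.negPart_nonneg a) a⁻
  obtain ⟨d, hd⟩ := CStarAlgebra.nonneg_iff_eq_star_mul_self.1 hnn
  refine ⟨a⁻, d, ?_, fun h => ?_⟩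
  · rw [← hd, hca, hc.star_eq, neg_mul]
  · rw [← hd] at h
    -- From `(a⁻)³ = 0` follows `(a⁻)⁴ = 0`, and the C*-identity, used twice, takes square roots.
    have hsq : IsSelfAdjoint (a⁻ * a⁻) := by simp [IsSelfAdjoint, hc.star_eq]
    have h2 : a⁻ * a⁻ = 0 := by
      rw [← CStarRing.star_mul_self_eq_zero_iff, hsq.star_eq, ← mul_assoc, h, zero_mul]
    have h1 : a⁻ = 0 := by
      rw [← CStarRing.star_mul_self_eq_zero_iff, hc.star_eq, h2]
    exact CStarAlgebra.nonneg_iff_eq_star_mul_self.1 ((CFC.negPart_eq_zero_iff a ha).1 h1)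

/-- Exchanging `r` and `q` makes the one-sided bound two-sided, hence `‖a r - a q‖ ≤ r + q`; the
limit along `r = 1 / (n + 1)` is then within `r` of every `a r`. -/
theorem exists_limit_of_order_cauchy (a : ℝ → B) (hsa : ∀ r, 0 < r → IsSelfAdjoint (a r))
    (h : ∀ r q, 0 < r → 0 < q → ∃ b : B, ((r + q : ℝ) : ℂ) • 1 - (a r - a q) = star b * b) :
    ∃ l : B, ∀ r : ℝ, 0 < r →
      (∃ b : B, (r : ℂ) • 1 + (l - a r) = star b * b) ∧
      (∃ b : B, (r : ℂ) • 1 - (l - a r) = star b * b) := by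
  have hmap : ∀ r : ℝ, (r : ℂ) • (1 : B) = algebraMap ℝ B r := fun r => by
    rw [Algebra.algebraMap_eq_smul_one, Complex.coe_smul]
  simp only [hmap] at h ⊢
  let _ := CStarAlgebra.spectralOrder B
  have := CStarAlgebra.spectralOrderedRing B
  have hle : ∀ r q, 0 < r → 0 < q → a r - a q ≤ algebraMap ℝ B (r + q) := fun r q hr hq => by
    obtain ⟨b, hb⟩ := h r q hr hq
    rw [← sub_nonneg, hb]
    exact star_mul_self_nonneg b
  have key : ∀ (x : B) (r : ℝ), 0 ≤ r → IsSelfAdjoint x →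
      x ≤ algebraMap ℝ B r → -x ≤ algebraMap ℝ B r → ‖x‖ ≤ r := by
    intro x r hr hx h1 h2
    rcases subsingleton_or_nontrivial B with _ | _
    · simpa [Subsingleton.elim x 0] using hr
    · rcases CStarAlgebra.norm_or_neg_norm_mem_spectrum hx with h | h
      · exact (le_algebraMap_iff_spectrum_le hx).1 h1 _ h
      · have := (algebraMap_le_iff_le_spectrum (r := -r) hx).1
          (by rw [map_neg]; exact neg_le.1 h2) _ h
        linarith
  have hnorm : ∀ r q, 0 < r → 0 < q → ‖a r - a q‖ ≤ r + q := fun r q hr hq =>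
    key _ _ (by positivity) ((hsa r hr).sub (hsa q hq)) (hle r q hr hq)
      (by rw [neg_sub, add_comm]; exact hle q r hq hr)
  let u : ℕ → ℝ := fun n => 1 / (n + 1)
  have hu : ∀ n, 0 < u n := fun n => by positivity
  have hu0 : Filter.Tendsto u Filter.atTop (nhds 0) := tendsto_one_div_add_atTop_nhds_zero_nat
  have hcau : CauchySeq fun n => a (u n) := by
    refine cauchySeq_of_le_tendsto_0 (fun n => u n + u n) (fun n m N hn hm => ?_)
      (by simpa using hu0.add hu0)
    rw [dist_eq_norm]
    refine (hnorm _ _ (hu n) (hu m)).trans (add_le_add ?_ ?_)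
    · exact Nat.one_div_le_one_div hn
    · exact Nat.one_div_le_one_div hm
  obtain ⟨l, hl⟩ := cauchySeq_tendsto_of_complete hcau
  have hlsa : IsSelfAdjoint l :=
    tendsto_nhds_unique (hl.star.congr fun n => (hsa _ (hu n)).star_eq) hl
  refine ⟨l, fun r hr => ?_⟩
  have hb : ‖l - a r‖ ≤ r := by
    have h1 : Filter.Tendsto (fun n => ‖a (u n) - a r‖) Filter.atTop (nhds ‖l - a r‖) :=
      (hl.sub_const _).norm
    have h2 : Filter.Tendsto (fun n => u n + r) Filter.atTop (nhds r) := by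
      simpa using hu0.add_const r
    exact le_of_tendsto_of_tendsto' h1 h2 fun n => hnorm _ _ (hu n) hr
  have hsal : IsSelfAdjoint (l - a r) := hlsa.sub (hsa r hr)
  have hmono : algebraMap ℝ B ‖l - a r‖ ≤ algebraMap ℝ B r := algebraMap_mono B hb
  constructor
  · refine CStarAlgebra.nonneg_iff_eq_star_mul_self.1 ?_
    have := hsal.neg_algebraMap_norm_le_self
    rw [← neg_le_iff_add_nonneg']
    exact (neg_le_neg hmono).trans this
  · refine CStarAlgebra.nonneg_iff_eq_star_mul_self.1 (sub_nonneg.2 ?_)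
    exact hsal.le_algebraMap_norm_self.trans hmono

end CStarOrder

/-! ### The same facts for matrices over `A`, read in the C*-algebra `CStarMatrix`. -/

namespace OperatorSystem

theorem exists_conjugate_eq_neg_conjTranspose_mul_self {A : Type u} [CStarAlgebra A] {n : ℕ}
    {a : Matrix (Fin n) (Fin n) A} (ha : aᴴ = a) :
    ∃ c d : Matrix (Fin n) (Fin n) A,
      c * a * cᴴ = -(dᴴ * d) ∧ (dᴴ * d = 0 → a ∈ cstarCone A n) := by
  let _ := CStarAlgebra.spectralOrder A
  have := CStarAlgebra.spectralOrderedRing A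
  exact exists_conjugate_eq_neg_star_mul_self (B := CStarMatrix (Fin n) (Fin n) A) ha

theorem exists_limit_of_cstarCone_cauchy {A : Type u} [CStarAlgebra A] {n : ℕ}
    (a : ℝ → Matrix (Fin n) (Fin n) A) (hsa : ∀ r, 0 < r → (a r)ᴴ = a r)
    (h : ∀ r q, 0 < r → 0 < q → ((r + q : ℝ) : ℂ) • 1 - (a r - a q) ∈ cstarCone A n) :
    ∃ l : Matrix (Fin n) (Fin n) A, ∀ r : ℝ, 0 < r →
      (r : ℂ) • 1 + (l - a r) ∈ cstarCone A n ∧ (r : ℂ) • 1 - (l - a r) ∈ cstarCone A n := by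
  let _ := CStarAlgebra.spectralOrder A
  have := CStarAlgebra.spectralOrderedRing A
  exact exists_limit_of_order_cauchy (B := CStarMatrix (Fin n) (Fin n) A) a hsa h

end OperatorSystem

/-! ### Elementary properties of matrix cones. -/

namespace OperatorSystem

variable {V : Type u} [OperatorSystem V]

theorem unit_mem_cone (n : ℕ) : Matrix.diagonal (fun _ => (unit : V)) ∈ cone n := by
  obtain ⟨r, hr, h⟩ := order_unit n (0 : Matrix (Fin n) (Fin n) V) (by simp)
  have := cone_smul n r⁻¹ (by positivity) _ h
  rwa [sub_zero, smul_smul, ← Complex.ofReal_mul, inv_mul_cancel₀ hr.ne', Complex.ofReal_one,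
    one_smul] at this

theorem zero_mem_cone (n : ℕ) : (0 : Matrix (Fin n) (Fin n) V) ∈ cone n := by
  simpa using cone_smul n 0 le_rfl _ (unit_mem_cone (V := V) n)

theorem conjTranspose_diagonal_unit (n : ℕ) :
    (Matrix.diagonal (fun _ : Fin n => (unit : V)))ᴴ = Matrix.diagonal fun _ => unit := by
  rw [Matrix.diagonal_conjTranspose]
  congr 1
  funext
  exact star_unit

theorem conjTranspose_real_smul {n : ℕ} (r : ℝ)
    (x : Matrix (Fin n) (Fin n) V) : ((r : ℂ) • x)ᴴ = (r : ℂ) • xᴴ := by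
  rw [Matrix.conjTranspose_smul, Complex.star_def, Complex.conj_ofReal]

/-- The hermitian hypothesis of `archimedean` is automatic, since `e + x` is positive and `e` is
hermitian. -/
theorem mem_cone_of_forall_smul_add {n : ℕ} {x : Matrix (Fin n) (Fin n) V}
    (h : ∀ r : ℝ, 0 < r → (r : ℂ) • Matrix.diagonal (fun _ => unit) + x ∈ cone n) :
    x ∈ cone n := by
  refine archimedean n x ?_ h
  have := cone_hermitian n _ (h 1 one_pos)
  rwa [Matrix.conjTranspose_add, conjTranspose_real_smul, conjTranspose_diagonal_unit,
    add_right_inj] at this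

end OperatorSystem

/-- The compression `a · x · a*` of a matrix `x` by a matrix `a` over `A`. -/
def matrixConj {A : Type u} {S : Type v} [Star A] [SMul A S] [SMul Aᵐᵒᵖ S] [AddCommMonoid S]
    {n m : ℕ} (a : Matrix (Fin n) (Fin m) A) (x : Matrix (Fin m) (Fin m) S) :
    Matrix (Fin n) (Fin n) S :=
  matrixRightAct (matrixLeftAct a x) aᴴ

/-! ### Compressions by matrices over `A`. -/

section Conj

variable {A : Type w} [CStarAlgebra A] {n m : ℕ}

theorem matrixConj_apply {S : Type v} [AddCommGroup S] [Module A S] [Module Aᵐᵒᵖ S]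
    (a : Matrix (Fin n) (Fin m) A) (x : Matrix (Fin m) (Fin m) S) (i j : Fin n) :
    matrixConj a x i j = ∑ l, ∑ k, op (star (a j l)) • a i k • x k l := by
  simp [matrixConj, matrixRightAct, matrixLeftAct, Finset.smul_sum]

theorem matrixConj_add {S : Type v} [AddCommGroup S] [Module A S] [Module Aᵐᵒᵖ S]
    (a : Matrix (Fin n) (Fin m) A) (x y : Matrix (Fin m) (Fin m) S) :
    matrixConj a (x + y) = matrixConj a x + matrixConj a y := by
  ext i j
  simp [matrixConj_apply, Finset.sum_add_distrib]

theorem matrixConj_map {S : Type u} {T : Type v} [AddCommGroup S] [Module A S] [Module Aᵐᵒᵖ S]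
    [AddCommGroup T] [Module A T] [Module Aᵐᵒᵖ T] {F : Type*} [FunLike F S T]
    [AddMonoidHomClass F S T] (φ : F)
    (hl : ∀ (a : A) (s : S), φ (a • s) = a • φ s)
    (hr : ∀ (a : A) (s : S), φ (op a • s) = op a • φ s)
    (a : Matrix (Fin n) (Fin m) A) (x : Matrix (Fin m) (Fin m) S) :
    (matrixConj a x).map φ = matrixConj a (x.map φ) := by
  ext i j
  simp [matrixConj_apply, hl, hr, -op_star]

end Conj

/-! ### The copy of `A` inside an operator `A`-system. -/

namespace OperatorASystem

open OperatorSystem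

variable {A : Type w} [CStarAlgebra A] {S : Type u} [OperatorSystem S] [Module A S]
  [Module Aᵐᵒᵖ S] {n m : ℕ}

theorem ofAlgebra_apply [OperatorASystem A S] (a : A) : ofAlgebra A S a = a • unit := rfl

theorem matrixConj_smul [OperatorASystem A S] (a : Matrix (Fin n) (Fin m) A) (z : ℂ)
    (x : Matrix (Fin m) (Fin m) S) : matrixConj a (z • x) = z • matrixConj a x := by
  have := OperatorASystem.isScalarTower_op (A := A) (S := S)
  ext i j
  simp only [matrixConj_apply, Matrix.smul_apply, Finset.smul_sum]
  refine Finset.sum_congr rfl fun l _ => Finset.sum_congr rfl fun k _ => ?_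
  rw [smul_comm (a i k) z, smul_comm (op _) z]

theorem matrixConj_mem_cone [OperatorASystem A S] (a : Matrix (Fin n) (Fin m) A)
    {x : Matrix (Fin m) (Fin m) S} (hx : x ∈ OperatorSystem.cone m) :
    matrixConj a x ∈ OperatorSystem.cone n :=
  OperatorASystem.cone_compatible n m a x hx

theorem op_smul_ofAlgebra [OperatorASystem A S] (a b : A) :
    op b • ofAlgebra A S a = ofAlgebra A S (a * b) := by
  rw [ofAlgebra_apply, ofAlgebra_apply, smul_unit a, smul_unit (a * b), op_mul, mul_smul]

theorem smul_ofAlgebra [OperatorASystem A S] (a b : A) :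
    b • ofAlgebra A S a = ofAlgebra A S (b * a) := by
  rw [ofAlgebra_apply, ofAlgebra_apply, mul_smul]

theorem star_ofAlgebra [OperatorASystem A S] (a : A) :
    star (ofAlgebra A S a) = ofAlgebra A S (star a) := by
  rw [ofAlgebra_apply, ofAlgebra_apply, star_smul, star_unit, smul_unit (star a)]

theorem matrixConj_map_ofAlgebra [OperatorASystem A S] (c : Matrix (Fin n) (Fin m) A)
    (a : Matrix (Fin m) (Fin m) A) :
    matrixConj c (a.map (ofAlgebra A S)) = (c * a * cᴴ).map (ofAlgebra A S) := by
  ext i j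
  simp [matrixConj_apply, smul_ofAlgebra, op_smul_ofAlgebra, Matrix.mul_apply, Finset.sum_mul,
    -op_star]

theorem conjTranspose_map_ofAlgebra [OperatorASystem A S] (a : Matrix (Fin n) (Fin n) A) :
    (a.map (ofAlgebra A S))ᴴ = aᴴ.map (ofAlgebra A S) := by
  ext i j
  simp [star_ofAlgebra]

theorem one_map_ofAlgebra [OperatorASystem A S] :
    (1 : Matrix (Fin n) (Fin n) A).map (ofAlgebra A S) = Matrix.diagonal fun _ => unit := by
  ext i j
  by_cases h : i = j <;> simp [h, ofAlgebra_apply]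

theorem map_ofAlgebra_mem_cone [OperatorASystem A S] {a : Matrix (Fin n) (Fin n) A}
    (ha : a ∈ cstarCone A n) : a.map (ofAlgebra A S) ∈ cone n := by
  obtain ⟨b, rfl⟩ := ha
  have := matrixConj_mem_cone bᴴ (unit_mem_cone (V := S) n)
  rwa [← one_map_ofAlgebra (A := A), matrixConj_map_ofAlgebra, mul_one,
    Matrix.conjTranspose_conjTranspose] at this

theorem IsFaithful.injective [OperatorASystem A S] (hS : IsFaithful A S) :
    Function.Injective (ofAlgebra A S) :=
  (injective_iff_map_eq_zero _).2 fun a ha => by_contra fun h => hS a h ha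

theorem IsFaithful.map_injective [OperatorASystem A S] (hS : IsFaithful A S) :
    Function.Injective fun a : Matrix (Fin n) (Fin m) A => a.map (ofAlgebra A S) :=
  Matrix.map_injective hS.injective

theorem IsFaithful.conjTranspose_eq_of_map_mem_cone [OperatorASystem A S] (hS : IsFaithful A S)
    {a : Matrix (Fin n) (Fin n) A} (ha : a.map (ofAlgebra A S) ∈ cone n) : aᴴ = a :=
  hS.map_injective <| by
    simpa [conjTranspose_map_ofAlgebra] using cone_hermitian n _ ha

/-- If `a` had a negative part, compressing `a · e` would make `-(dᴴ * d) · e` positive alongside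
`(dᴴ * d) · e`. Properness then gives `(dᴴ * d) · e = 0`, and faithfulness gives `dᴴ * d = 0`. -/
theorem IsFaithful.mem_cstarCone [OperatorASystem A S] (hS : IsFaithful A S)
    {a : Matrix (Fin n) (Fin n) A} (ha : a.map (ofAlgebra A S) ∈ cone n) : a ∈ cstarCone A n := by
  obtain ⟨c, d, hcd, h⟩ := exists_conjugate_eq_neg_conjTranspose_mul_self
    (hS.conjTranspose_eq_of_map_mem_cone ha)
  have hneg := matrixConj_mem_cone c ha
  rw [matrixConj_map_ofAlgebra, hcd] at hneg
  have hpos : (dᴴ * d).map (ofAlgebra A S) ∈ cone n := map_ofAlgebra_mem_cone ⟨d, rfl⟩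
  refine h (hS.map_injective ?_)
  have hz : (0 : Matrix (Fin n) (Fin n) A).map (ofAlgebra A S) = 0 :=
    Matrix.map_zero _ (map_zero _)
  simp only [hz]
  refine cone_proper n _ hpos ?_
  rwa [Matrix.map_neg _ (map_neg _)] at hneg

theorem IsFaithful.isCompleteOrderEmbedding [OperatorASystem A S] (hS : IsFaithful A S) :
    IsCompleteOrderEmbedding (cstarCone A) cone (ofAlgebra A S) :=
  ⟨hS.injective, fun _ _ => ⟨map_ofAlgebra_mem_cone, hS.mem_cstarCone⟩⟩

namespace IsMorphism

variable {R : Type v} [OperatorSystem R] [Module A R] [Module Aᵐᵒᵖ R] {φ : S →ₗ[ℂ] R}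

theorem map_smul (h : IsMorphism A φ) (a : A) (s : S) : φ (a • s) = a • φ s := by
  simpa using h.bimodule a 1 s

theorem map_ofAlgebra [OperatorASystem A S] [OperatorASystem A R] (h : IsMorphism A φ) (a : A) :
    φ (ofAlgebra A S a) = ofAlgebra A R a := by
  rw [ofAlgebra_apply, ofAlgebra_apply, h.map_smul, h.unital]

end IsMorphism

end OperatorASystem

/-! ### The amalgamated sum as a `*`-vector space and bimodule. -/

namespace OperatorASystem

open OperatorSystem

noncomputable section Amalgam

variable (A : Type w) [CStarAlgebra A]
  (S : Type u) [OperatorSystem S] [Module A S] [Module Aᵐᵒᵖ S] [OperatorASystem A S]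
  (T : Type v) [OperatorSystem T] [Module A T] [Module Aᵐᵒᵖ T] [OperatorASystem A T]

/-- The subgroup `{(a · e, -a · e)}` of `S × T`. -/
def amalgamKer : AddSubgroup (S × T) :=
  ((ofAlgebra A S).toAddMonoidHom.prod (-(ofAlgebra A T).toAddMonoidHom)).range

/-- The quotient of `S × T` that identifies the copies of `A` in `S` and in `T`. -/
def Amalgam : Type max u v := (S × T) ⧸ amalgamKer A S T

namespace Amalgam

instance : AddCommGroup (Amalgam A S T) :=
  inferInstanceAs (AddCommGroup ((S × T) ⧸ amalgamKer A S T))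

/-- The quotient map onto the amalgam. -/
def mk : S × T →+ Amalgam A S T := QuotientAddGroup.mk' (amalgamKer A S T)

variable {A S T}

theorem mk_surjective : Function.Surjective (mk A S T) :=
  QuotientAddGroup.mk'_surjective _

theorem mk_eq_zero_iff {x : S × T} :
    mk A S T x = 0 ↔ ∃ a : A, (ofAlgebra A S a, -ofAlgebra A T a) = x :=
  QuotientAddGroup.eq_zero_iff x

/-- The endomorphism of the amalgam induced by an endomorphism of `S × T`. -/
def lift (f : S × T →+ S × T) (hf : ∀ a : A, mk A S T (f (ofAlgebra A S a, -ofAlgebra A T a)) = 0) :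
    Amalgam A S T →+ Amalgam A S T :=
  QuotientAddGroup.lift _ ((mk A S T).comp f) <| by
    rintro _ ⟨a, rfl⟩
    exact hf a

instance : SMul ℂ (Amalgam A S T) where
  smul z := lift (DistribSMul.toAddMonoidHom _ z) fun a =>
    mk_eq_zero_iff.2 ⟨z • a, by simp⟩

instance : SMul A (Amalgam A S T) where
  smul b := lift (DistribSMul.toAddMonoidHom _ b) fun a =>
    mk_eq_zero_iff.2 ⟨b * a, by simp [smul_ofAlgebra]⟩

instance : SMul Aᵐᵒᵖ (Amalgam A S T) where
  smul b := lift (DistribSMul.toAddMonoidHom _ b) fun a =>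
    mk_eq_zero_iff.2 ⟨a * b.unop, by simp [← op_smul_ofAlgebra]⟩

instance : Star (Amalgam A S T) where
  star := lift (starAddEquiv : S × T ≃+ S × T).toAddMonoidHom fun a =>
    mk_eq_zero_iff.2 ⟨star a, by simp [star_ofAlgebra, Prod.star_def]⟩

theorem mk_smul (z : ℂ) (x : S × T) : mk A S T (z • x) = z • mk A S T x := rfl

theorem mk_smul_left (a : A) (x : S × T) : mk A S T (a • x) = a • mk A S T x := rfl

theorem mk_smul_right (a : Aᵐᵒᵖ) (x : S × T) : mk A S T (a • x) = a • mk A S T x := rfl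

theorem mk_star (x : S × T) : mk A S T (star x) = star (mk A S T x) := rfl

instance : Module ℂ (Amalgam A S T) := mk_surjective.module ℂ (mk A S T) mk_smul

instance : Module A (Amalgam A S T) := mk_surjective.module A (mk A S T) mk_smul_left

instance : Module Aᵐᵒᵖ (Amalgam A S T) := mk_surjective.module Aᵐᵒᵖ (mk A S T) mk_smul_right

instance : StarAddMonoid (Amalgam A S T) where
  star_involutive := mk_surjective.forall.2 fun x => by rw [← mk_star, ← mk_star, star_star]
  star_add := mk_surjective.forall₂.2 fun x y => by
    simp only [← map_add, ← mk_star, star_add]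

instance : StarModule ℂ (Amalgam A S T) where
  star_smul z := mk_surjective.forall.2 fun x => by
    simp only [← mk_smul, ← mk_star, StarModule.star_smul]

variable (A S T) in
/-- The canonical map of `S` into the amalgam. -/
def inl : S →ₗ[ℂ] Amalgam A S T where
  toFun s := mk A S T (s, 0)
  map_add' s s' := by simp [← map_add]
  map_smul' z s := by simp [← mk_smul]

variable (A S T) in
/-- The canonical map of `T` into the amalgam. -/
def inr : T →ₗ[ℂ] Amalgam A S T where
  toFun t := mk A S T (0, t)
  map_add' s s' := by simp [← map_add]
  map_smul' z s := by simp [← mk_smul]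

theorem inl_add_inr (s : S) (t : T) : inl A S T s + inr A S T t = mk A S T (s, t) := by
  simp [inl, inr, ← map_add]

theorem exists_eq_inl_add_inr (x : Amalgam A S T) : ∃ s t, x = inl A S T s + inr A S T t := by
  obtain ⟨⟨s, t⟩, rfl⟩ := mk_surjective x
  exact ⟨s, t, (inl_add_inr s t).symm⟩

theorem inl_add_inr_eq_zero_iff {s : S} {t : T} : inl A S T s + inr A S T t = 0 ↔
    ∃ a : A, s = ofAlgebra A S a ∧ t = -ofAlgebra A T a := by
  rw [inl_add_inr, mk_eq_zero_iff]
  simp [Prod.ext_iff, eq_comm]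

theorem inl_smul (a : A) (s : S) : inl A S T (a • s) = a • inl A S T s := by
  simp [inl, ← mk_smul_left]

theorem inr_smul (a : A) (t : T) : inr A S T (a • t) = a • inr A S T t := by
  simp [inr, ← mk_smul_left]

theorem inl_op_smul (a : A) (s : S) : inl A S T (op a • s) = op a • inl A S T s := by
  simp [inl, ← mk_smul_right]

theorem inr_op_smul (a : A) (t : T) : inr A S T (op a • t) = op a • inr A S T t := by
  simp [inr, ← mk_smul_right]

theorem inl_star (s : S) : inl A S T (star s) = star (inl A S T s) := by
  simp [inl, ← mk_star, Prod.star_def]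

theorem inr_star (t : T) : inr A S T (star t) = star (inr A S T t) := by
  simp [inr, ← mk_star, Prod.star_def]

theorem inl_ofAlgebra (a : A) :
    inl A S T (ofAlgebra A S a) = inr A S T (ofAlgebra A T a) := by
  rw [← sub_eq_zero, sub_eq_add_neg, ← map_neg, inl_add_inr_eq_zero_iff]
  exact ⟨a, rfl, rfl⟩

theorem inl_unit : inl A S T unit = inr A S T unit := by
  simpa [ofAlgebra_apply] using inl_ofAlgebra (A := A) (S := S) (T := T) 1

variable {n m : ℕ}

variable (A) in
/-- The matrix `s + t` over the amalgam. -/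
def comb (s : Matrix (Fin n) (Fin n) S) (t : Matrix (Fin n) (Fin n) T) :
    Matrix (Fin n) (Fin n) (Amalgam A S T) :=
  s.map (inl A S T) + t.map (inr A S T)

theorem exists_eq_comb (x : Matrix (Fin n) (Fin n) (Amalgam A S T)) :
    ∃ s t, x = comb A s t := by
  choose s t h using fun i j => exists_eq_inl_add_inr (x i j)
  exact ⟨s, t, by ext i j; exact h i j⟩

theorem comb_add (s s' : Matrix (Fin n) (Fin n) S) (t t' : Matrix (Fin n) (Fin n) T) :
    comb A s t + comb A s' t' = comb A (s + s') (t + t') := by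
  ext i j
  simp [comb, add_add_add_comm]

theorem comb_smul (z : ℂ) (s : Matrix (Fin n) (Fin n) S) (t : Matrix (Fin n) (Fin n) T) :
    z • comb A s t = comb A (z • s) (z • t) := by
  ext i j
  simp [comb]

theorem comb_neg (s : Matrix (Fin n) (Fin n) S) (t : Matrix (Fin n) (Fin n) T) :
    -comb A s t = comb A (-s) (-t) := by
  simpa using comb_smul (A := A) (-1) s t

theorem comb_sub (s s' : Matrix (Fin n) (Fin n) S) (t t' : Matrix (Fin n) (Fin n) T) :
    comb A s t - comb A s' t' = comb A (s - s') (t - t') := by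
  rw [sub_eq_add_neg, comb_neg, comb_add, sub_eq_add_neg, sub_eq_add_neg]

theorem comb_conjTranspose (s : Matrix (Fin n) (Fin n) S) (t : Matrix (Fin n) (Fin n) T) :
    (comb A s t)ᴴ = comb A sᴴ tᴴ := by
  ext i j
  simp [comb, inl_star, inr_star]

theorem matrixConj_comb (a : Matrix (Fin n) (Fin m) A) (s : Matrix (Fin m) (Fin m) S)
    (t : Matrix (Fin m) (Fin m) T) :
    matrixConj a (comb A s t) = comb A (matrixConj a s) (matrixConj a t) := by
  rw [comb, comb, matrixConj_add, matrixConj_map _ inl_smul inl_op_smul,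
    matrixConj_map _ inr_smul inr_op_smul]

theorem comb_eq_zero_iff {s : Matrix (Fin n) (Fin n) S} {t : Matrix (Fin n) (Fin n) T} :
    comb A s t = 0 ↔ ∃ a : Matrix (Fin n) (Fin n) A,
      s = a.map (ofAlgebra A S) ∧ t = -a.map (ofAlgebra A T) := by
  constructor
  · intro h
    choose a ha using fun i j => inl_add_inr_eq_zero_iff.1 (congrFun (congrFun h i) j)
    exact ⟨a, by ext i j; exact (ha i j).1, by ext i j; exact (ha i j).2⟩
  · rintro ⟨a, rfl, rfl⟩
    ext i j
    exact inl_add_inr_eq_zero_iff.2 ⟨a i j, rfl, rfl⟩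

/-- The only ambiguity in a decomposition is a transfer of a matrix over `A` between the summands;
every comparison of cones below rests on this. -/
theorem comb_eq_comb_iff {s s' : Matrix (Fin n) (Fin n) S} {t t' : Matrix (Fin n) (Fin n) T} :
    comb A s' t' = comb A s t ↔ ∃ a : Matrix (Fin n) (Fin n) A,
      s' = s + a.map (ofAlgebra A S) ∧ t' = t - a.map (ofAlgebra A T) := by
  rw [← sub_eq_zero, comb_sub, comb_eq_zero_iff]
  refine exists_congr fun a => and_congr sub_eq_iff_eq_add' ?_
  rw [sub_eq_iff_eq_add', sub_eq_add_neg]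

theorem diagonal_inl_unit :
    Matrix.diagonal (fun _ : Fin n => inl A S T unit) =
      comb A (Matrix.diagonal fun _ => unit) 0 := by
  ext i j
  by_cases h : i = j <;> simp [comb, h]

theorem diagonal_inl_unit' :
    Matrix.diagonal (fun _ : Fin n => inl A S T unit) =
      comb A 0 (Matrix.diagonal fun _ => unit) := by
  rw [inl_unit]
  ext i j
  by_cases h : i = j <;> simp [comb, h]

end Amalgam

end Amalgam

end OperatorASystem

/-! ### The matrix cones of the amalgam and their properness. -/

namespace OperatorASystem

open OperatorSystem

noncomputable section AmalgamCone

variable {A : Type w} [CStarAlgebra A]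
  {S : Type u} [OperatorSystem S] [Module A S] [Module Aᵐᵒᵖ S] [OperatorASystem A S]
  {T : Type v} [OperatorSystem T] [Module A T] [Module Aᵐᵒᵖ T] [OperatorASystem A T]
  {n m : ℕ}

namespace Amalgam

variable (A S T) in
/-- The sum of the images of the cones of `S` and `T`. -/
def sumCone (n : ℕ) : Set (Matrix (Fin n) (Fin n) (Amalgam A S T)) :=
  {x | ∃ s ∈ cone n, ∃ t ∈ cone n, x = comb A s t}

variable (A S T) in
/-- The matrix order unit of the amalgam. -/
def unitMatrix (n : ℕ) : Matrix (Fin n) (Fin n) (Amalgam A S T) :=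
  Matrix.diagonal fun _ => inl A S T unit

variable (A S T) in
/-- The Archimedean closure of `sumCone`. -/
def archCone (n : ℕ) : Set (Matrix (Fin n) (Fin n) (Amalgam A S T)) :=
  {x | ∀ r : ℝ, 0 < r → (r : ℂ) • unitMatrix A S T n + x ∈ sumCone A S T n}

theorem sumCone_add {x y : Matrix (Fin n) (Fin n) (Amalgam A S T)} (hx : x ∈ sumCone A S T n)
    (hy : y ∈ sumCone A S T n) : x + y ∈ sumCone A S T n := by
  obtain ⟨s, hs, t, ht, rfl⟩ := hx
  obtain ⟨s', hs', t', ht', rfl⟩ := hy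
  exact ⟨_, cone_add n _ hs _ hs', _, cone_add n _ ht _ ht', comb_add ..⟩

theorem sumCone_smul {r : ℝ} (hr : 0 ≤ r) {x : Matrix (Fin n) (Fin n) (Amalgam A S T)}
    (hx : x ∈ sumCone A S T n) : (r : ℂ) • x ∈ sumCone A S T n := by
  obtain ⟨s, hs, t, ht, rfl⟩ := hx
  exact ⟨_, cone_smul n r hr _ hs, _, cone_smul n r hr _ ht, comb_smul ..⟩

theorem sumCone_matrixConj (a : Matrix (Fin n) (Fin m) A)
    {x : Matrix (Fin m) (Fin m) (Amalgam A S T)} (hx : x ∈ sumCone A S T m) :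
    matrixConj a x ∈ sumCone A S T n := by
  obtain ⟨s, hs, t, ht, rfl⟩ := hx
  exact ⟨_, matrixConj_mem_cone a hs, _, matrixConj_mem_cone a ht, matrixConj_comb ..⟩

theorem sumCone_hermitian {x : Matrix (Fin n) (Fin n) (Amalgam A S T)}
    (hx : x ∈ sumCone A S T n) : xᴴ = x := by
  obtain ⟨s, hs, t, ht, rfl⟩ := hx
  rw [comb_conjTranspose, cone_hermitian n _ hs, cone_hermitian n _ ht]

theorem unitMatrix_mem_sumCone (n : ℕ) : unitMatrix A S T n ∈ sumCone A S T n :=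
  ⟨_, unit_mem_cone n, _, zero_mem_cone n, diagonal_inl_unit⟩

theorem sumCone_subset_archCone : sumCone A S T n ⊆ archCone A S T n := fun _ hx _ hr =>
  sumCone_add (sumCone_smul hr.le (unitMatrix_mem_sumCone n)) hx

theorem archCone_hermitian {x : Matrix (Fin n) (Fin n) (Amalgam A S T)}
    (hx : x ∈ archCone A S T n) : xᴴ = x := by
  have h1 := sumCone_hermitian (hx 1 one_pos)
  rwa [Complex.ofReal_one, one_smul, Matrix.conjTranspose_add,
    sumCone_hermitian (unitMatrix_mem_sumCone n), add_right_inj] at h1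

theorem archCone_add {x y : Matrix (Fin n) (Fin n) (Amalgam A S T)} (hx : x ∈ archCone A S T n)
    (hy : y ∈ archCone A S T n) : x + y ∈ archCone A S T n := fun r hr => by
  convert sumCone_add (hx (r / 2) (half_pos hr)) (hy (r / 2) (half_pos hr)) using 1
  rw [add_add_add_comm, ← add_smul, ← Complex.ofReal_add, add_halves]

theorem archCone_smul {r : ℝ} (hr : 0 ≤ r) {x : Matrix (Fin n) (Fin n) (Amalgam A S T)}
    (hx : x ∈ archCone A S T n) : (r : ℂ) • x ∈ archCone A S T n := by
  rcases hr.eq_or_lt with rfl | hr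
  · rw [Complex.ofReal_zero, zero_smul, ← zero_smul ℂ (unitMatrix A S T n)]
    exact sumCone_subset_archCone (by
      simpa using sumCone_smul le_rfl (unitMatrix_mem_sumCone (A := A) (S := S) (T := T) n))
  · intro q hq
    convert sumCone_smul hr.le (hx (q / r) (div_pos hq hr)) using 1
    rw [smul_add, smul_smul, ← Complex.ofReal_mul, mul_div_cancel₀ _ hr.ne']

theorem exists_hermitian_eq_comb {x : Matrix (Fin n) (Fin n) (Amalgam A S T)} (hx : xᴴ = x) :
    ∃ s t, sᴴ = s ∧ tᴴ = t ∧ x = comb A s t := by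
  obtain ⟨s, t, rfl⟩ := exists_eq_comb x
  rw [comb_conjTranspose] at hx
  refine ⟨((1 / 2 : ℝ) : ℂ) • (s + sᴴ), ((1 / 2 : ℝ) : ℂ) • (t + tᴴ), ?_, ?_, ?_⟩
  · rw [conjTranspose_real_smul, Matrix.conjTranspose_add, Matrix.conjTranspose_conjTranspose,
      add_comm]
  · rw [conjTranspose_real_smul, Matrix.conjTranspose_add, Matrix.conjTranspose_conjTranspose,
      add_comm]
  · rw [← comb_smul, ← comb_add, hx, ← two_smul ℂ (comb A s t), smul_smul]
    norm_num

theorem exists_sub_mem_sumCone {x : Matrix (Fin n) (Fin n) (Amalgam A S T)} (hx : xᴴ = x) :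
    ∃ r : ℝ, 0 < r ∧ (r : ℂ) • unitMatrix A S T n - x ∈ sumCone A S T n := by
  obtain ⟨s, t, hs, ht, rfl⟩ := exists_hermitian_eq_comb hx
  obtain ⟨r, hr, hrs⟩ := order_unit n s hs
  obtain ⟨q, hq, hqt⟩ := order_unit n t ht
  refine ⟨r + q, add_pos hr hq, _, hrs, _, hqt, ?_⟩
  rw [← comb_sub, Complex.ofReal_add, add_smul]
  congr 1
  nth_rewrite 2 [unitMatrix]
  -- The unit belongs to both summands: `r • e` is taken from `S` and `q • e` from `T`.
  rw [unitMatrix, diagonal_inl_unit, comb_smul, ← diagonal_inl_unit, diagonal_inl_unit',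
    comb_smul, comb_add]
  simp

/-- With `k` such that `k e - a e a*` lies in `sumCone`, write `r e + a x a* = (r/k)(k e - a e a*) +
a ((r/k) e + x) a*`. -/
theorem archCone_matrixConj (a : Matrix (Fin n) (Fin m) A)
    (hsmul : ∀ (z : ℂ) (x : Matrix (Fin m) (Fin m) (Amalgam A S T)),
      matrixConj a (z • x) = z • matrixConj a x)
    {x : Matrix (Fin m) (Fin m) (Amalgam A S T)} (hx : x ∈ archCone A S T m) :
    matrixConj a x ∈ archCone A S T n := by
  intro r hr
  obtain ⟨k, hk, h⟩ := exists_sub_mem_sumCone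
    (sumCone_hermitian (sumCone_matrixConj a (unitMatrix_mem_sumCone (A := A) (S := S) (T := T) m)))
  convert sumCone_add (sumCone_smul (div_pos hr hk).le h)
    (sumCone_matrixConj a (hx (r / k) (div_pos hr hk))) using 1
  rw [matrixConj_add, hsmul, ← add_assoc, ← smul_add, sub_add_cancel, smul_smul,
    ← Complex.ofReal_mul, div_mul_cancel₀ _ hk.ne']

/-- At each level `r`, the `T`-summand is some `-a · e`. Faithfulness of `T` makes `-a` positive in
`M_n(A)`, so it can be moved back into `S`. -/
theorem mem_cone_of_comb_zero_mem_archCone (hT : IsFaithful A T) {s : Matrix (Fin n) (Fin n) S}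
    (h : comb A s (0 : Matrix (Fin n) (Fin n) T) ∈ archCone A S T n) : s ∈ cone n := by
  refine mem_cone_of_forall_smul_add fun r hr => ?_
  obtain ⟨s', hs', t', ht', he⟩ := h r hr
  rw [unitMatrix, diagonal_inl_unit, comb_smul, comb_add, eq_comm, comb_eq_comb_iff] at he
  obtain ⟨a, rfl, rfl⟩ := he
  have ha : -a ∈ cstarCone A n := hT.mem_cstarCone <| by
    rw [Matrix.map_neg _ (map_neg _)]
    simpa using ht'
  have := cone_add n _ hs' _ (map_ofAlgebra_mem_cone (S := S) ha)
  rwa [Matrix.map_neg _ (map_neg _), add_neg_cancel_right] at this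

theorem mem_cone_of_comb_zero_mem_archCone' (hS : IsFaithful A S) {t : Matrix (Fin n) (Fin n) T}
    (h : comb A (0 : Matrix (Fin n) (Fin n) S) t ∈ archCone A S T n) : t ∈ cone n := by
  refine mem_cone_of_forall_smul_add fun r hr => ?_
  obtain ⟨s', hs', t', ht', he⟩ := h r hr
  rw [unitMatrix, diagonal_inl_unit', comb_smul, comb_add, eq_comm, comb_eq_comb_iff] at he
  obtain ⟨a, rfl, rfl⟩ := he
  have ha : a ∈ cstarCone A n := hS.mem_cstarCone <| by simpa using hs'
  have := cone_add n _ ht' _ (map_ofAlgebra_mem_cone (S := T) ha)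
  rwa [sub_add_cancel] at this

theorem eq_zero_of_forall_mem_cone {V : Type*} [OperatorSystem V] {x : Matrix (Fin n) (Fin n) V}
    {c d : ℝ} (hc : 0 < c) (hd : 0 < d)
    (h₁ : ∀ r : ℝ, 0 < r → ((c * r : ℝ) : ℂ) • Matrix.diagonal (fun _ => unit) + x ∈ cone n)
    (h₂ : ∀ r : ℝ, 0 < r → ((d * r : ℝ) : ℂ) • Matrix.diagonal (fun _ => unit) - x ∈ cone n) :
    x = 0 := by
  refine cone_proper n x (mem_cone_of_forall_smul_add fun r hr => ?_)
    (mem_cone_of_forall_smul_add fun r hr => ?_)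
  · simpa [mul_div_cancel₀ _ hc.ne', mul_div_cancel_left₀] using h₁ (r / c) (div_pos hr hc)
  · rw [← sub_eq_add_neg]
    have := h₂ (r / d) (div_pos hr hd)
    rwa [mul_div_cancel₀ _ hd.ne'] at this

/-- Decomposing `r e + x` and `r e - x` and comparing the corrections gives `-r ≤ s + a r ≤ r` in
`S` and `0 ≤ t - a r ≤ 2r` in `T`. So `a r` converges to some `l` with `s = -l · e` and `t = l · e`,
and `x = 0`. -/
theorem archCone_proper (hS : IsFaithful A S) (hT : IsFaithful A T)
    {x : Matrix (Fin n) (Fin n) (Amalgam A S T)}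
    (hx : x ∈ archCone A S T n) (hx' : -x ∈ archCone A S T n) : x = 0 := by
  obtain ⟨s, t, hs, -, rfl⟩ := exists_hermitian_eq_comb (archCone_hermitian hx)
  set J : Matrix (Fin n) (Fin n) A →ₗ[ℂ] Matrix (Fin n) (Fin n) S :=
    (ofAlgebra A S).mapMatrix with hJ
  set K : Matrix (Fin n) (Fin n) A →ₗ[ℂ] Matrix (Fin n) (Fin n) T :=
    (ofAlgebra A T).mapMatrix with hK
  have hJ1 : Matrix.diagonal (fun _ => unit) = J 1 := one_map_ofAlgebra.symm
  have hK1 : Matrix.diagonal (fun _ => unit) = K 1 := one_map_ofAlgebra.symm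
  have hJpos {a} : a ∈ cstarCone A n → J a ∈ cone n := map_ofAlgebra_mem_cone
  have hKpos {a} : a ∈ cstarCone A n → K a ∈ cone n := map_ofAlgebra_mem_cone
  -- The condition `0 < r` sits under the existential so that `choose` gives a function on all of
  -- `ℝ`; its value at `r ≤ 0` is irrelevant.
  have hA : ∀ r : ℝ, ∃ a : Matrix (Fin n) (Fin n) A, 0 < r →
      (r : ℂ) • J 1 + s + J a ∈ cone n ∧ t - K a ∈ cone n := fun r => by
    by_cases hr : 0 < r
    · obtain ⟨s', hs', t', ht', he⟩ := hx r hr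
      rw [unitMatrix, diagonal_inl_unit, comb_smul, comb_add, eq_comm, comb_eq_comb_iff] at he
      obtain ⟨a, rfl, rfl⟩ := he
      exact ⟨a, fun _ => ⟨by rwa [hJ1] at hs', by rwa [smul_zero, zero_add] at ht'⟩⟩
    · exact ⟨0, fun h => absurd h hr⟩
  have hB : ∀ r : ℝ, 0 < r → ∃ b : Matrix (Fin n) (Fin n) A,
      (r : ℂ) • J 1 - s + J b ∈ cone n ∧ -t - K b ∈ cone n := fun r hr => by
    obtain ⟨s', hs', t', ht', he⟩ := hx' r hr
    rw [comb_neg, unitMatrix, diagonal_inl_unit, comb_smul, comb_add, eq_comm,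
      comb_eq_comb_iff] at he
    obtain ⟨b, rfl, rfl⟩ := he
    exact ⟨b, by rwa [hJ1, ← sub_eq_add_neg] at hs', by rwa [smul_zero, zero_add] at ht'⟩
  choose a ha using hA
  have hsa : ∀ r, 0 < r → (a r)ᴴ = a r := fun r hr => by
    have := cone_hermitian n _ (ha r hr).1
    rw [Matrix.conjTranspose_add, Matrix.conjTranspose_add, hs, ← hJ1, conjTranspose_real_smul,
      conjTranspose_diagonal_unit, add_right_inj] at this
    exact hS.map_injective ((conjTranspose_map_ofAlgebra _).symm.trans this)
  have hupper : ∀ r : ℝ, 0 < r → (r : ℂ) • J 1 - s - J (a r) ∈ cone n := fun r hr => by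
    obtain ⟨b, hb, hb'⟩ := hB r hr
    -- Adding the two `T`-summands cancels `t` and leaves a positive element of `M_n(A) · e`.
    have hab : -(a r + b) ∈ cstarCone A n := hT.mem_cstarCone <| by
      change K _ ∈ _
      convert cone_add n _ (ha r hr).2 _ hb' using 1
      rw [map_neg, map_add]
      abel
    convert cone_add n _ hb _ (hJpos hab) using 1
    rw [map_neg, map_add]
    abel
  have hupper' : ∀ r : ℝ, 0 < r → ((2 * r : ℝ) : ℂ) • K 1 - t + K (a r) ∈ cone n := fun r hr => by
    obtain ⟨b, hb, hb'⟩ := hB r hr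
    have hab : ((2 * r : ℝ) : ℂ) • 1 + (a r + b) ∈ cstarCone A n := hS.mem_cstarCone <| by
      change J _ ∈ _
      convert cone_add n _ (ha r hr).1 _ hb using 1
      simp only [map_add, map_smul, Complex.ofReal_mul, Complex.ofReal_ofNat]
      module
    convert cone_add n _ hb' _ (hKpos hab) using 1
    simp only [map_add, map_smul]
    abel
  obtain ⟨l, hl⟩ := exists_limit_of_cstarCone_cauchy a hsa fun r q hr hq =>
    hS.mem_cstarCone <| by
      change J _ ∈ _
      convert cone_add n _ (hupper r hr) _ (ha q hq).1 using 1
      simp only [map_sub, map_smul, Complex.ofReal_add]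
      module
  have hsl : s + J l = 0 := by
    refine eq_zero_of_forall_mem_cone two_pos two_pos (fun r hr => ?_) fun r hr => ?_
    · convert cone_add n _ (ha r hr).1 _ (hJpos (hl r hr).1) using 1
      simp only [map_add, map_sub, map_smul, Complex.ofReal_mul, Complex.ofReal_ofNat, hJ1]
      module
    · convert cone_add n _ (hupper r hr) _ (hJpos (hl r hr).2) using 1
      simp only [map_sub, map_smul, Complex.ofReal_mul, Complex.ofReal_ofNat, hJ1]
      module
  have htl : t - K l = 0 := by
    -- The bounds `0` and `2r` on `t - a r` each lose another `r` from `l - a r`.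
    refine eq_zero_of_forall_mem_cone one_pos three_pos (fun r hr => ?_) fun r hr => ?_
    · convert cone_add n _ (ha r hr).2 _ (hKpos (hl r hr).2) using 1
      simp only [map_sub, map_smul, one_mul, hK1]
      module
    · convert cone_add n _ (hupper' r hr) _ (hKpos (hl r hr).1) using 1
      simp only [map_add, map_sub, map_smul, Complex.ofReal_mul, Complex.ofReal_ofNat, hK1]
      module
  refine comb_eq_zero_iff.2 ⟨-l, ?_, ?_⟩
  · change s = J (-l)
    rw [map_neg, ← add_eq_zero_iff_eq_neg, hsl]
  · change t = -K (-l)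
    rw [map_neg, neg_neg, ← sub_eq_zero, htl]

end Amalgam

end AmalgamCone

end OperatorASystem

/-! ### The amalgam as an operator `A`-system and its universal property. -/

namespace OperatorASystem

open OperatorSystem

noncomputable section AmalgamSystem

variable {A : Type w} [CStarAlgebra A]
  {S : Type u} [OperatorSystem S] [Module A S] [Module Aᵐᵒᵖ S] [OperatorASystem A S]
  {T : Type v} [OperatorSystem T] [Module A T] [Module Aᵐᵒᵖ T] [OperatorASystem A T]
  {n m : ℕ}

namespace Amalgam

instance : SMulCommClass A Aᵐᵒᵖ (Amalgam A S T) where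
  smul_comm a b := mk_surjective.forall.2 fun x => by
    rw [← mk_smul_left, ← mk_smul_right, ← mk_smul_right, ← mk_smul_left, smul_comm]

instance : IsScalarTower ℂ A (Amalgam A S T) where
  smul_assoc z a := mk_surjective.forall.2 fun x => by
    rw [← mk_smul_left, ← mk_smul_left, ← mk_smul, smul_assoc]

instance : IsScalarTower ℂ Aᵐᵒᵖ (Amalgam A S T) where
  smul_assoc z a := mk_surjective.forall.2 fun x => by
    have := OperatorASystem.isScalarTower_op (A := A) (S := S)
    have := OperatorASystem.isScalarTower_op (A := A) (S := T)
    rw [← mk_smul_right, ← mk_smul_right, ← mk_smul, smul_assoc]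

theorem matrixConj_smul (a : Matrix (Fin n) (Fin m) A) (z : ℂ)
    (x : Matrix (Fin m) (Fin m) (Amalgam A S T)) :
    matrixConj a (z • x) = z • matrixConj a x := by
  obtain ⟨s, t, rfl⟩ := exists_eq_comb x
  rw [comb_smul, matrixConj_comb, matrixConj_comb, comb_smul, OperatorASystem.matrixConj_smul,
    OperatorASystem.matrixConj_smul]

/-- Scalar matrices act through `ℂ · 1 ⊆ A`, so scalar compatibility of the cones is a case of
`A`-compatibility. -/
theorem matrixConj_map_algebraMap (X : Matrix (Fin m) (Fin n) ℂ)
    (x : Matrix (Fin n) (Fin n) (Amalgam A S T)) :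
    matrixConj (X.map (algebraMap ℂ A)) x =
      Matrix.of fun i j => ∑ k, ∑ l, (X i k * starRingEnd ℂ (X j l)) • x k l := by
  ext i j
  rw [matrixConj_apply, Finset.sum_comm]
  refine Finset.sum_congr rfl fun k _ => Finset.sum_congr rfl fun l _ => ?_
  have hop : op (star (algebraMap ℂ A (X j l))) = starRingEnd ℂ (X j l) • (1 : Aᵐᵒᵖ) := by
    rw [← algebraMap_star_comm, Algebra.algebraMap_eq_smul_one]
    rfl
  rw [Matrix.map_apply, Matrix.map_apply, hop, algebraMap_smul, smul_assoc, one_smul, smul_smul,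
    mul_comm]

/-- The operator system structure of the amalgam. -/
abbrev operatorSystem (hS : IsFaithful A S) (hT : IsFaithful A T) :
    OperatorSystem (Amalgam A S T) where
  unit := inl A S T unit
  cone := archCone A S T
  star_unit := by rw [← inl_star, OperatorSystem.star_unit]
  cone_hermitian _ _ := archCone_hermitian
  cone_nonempty n := ⟨_, sumCone_subset_archCone (unitMatrix_mem_sumCone n)⟩
  cone_add _ _ hx _ hy := archCone_add hx hy
  cone_smul _ _ hr _ hx := archCone_smul hr hx
  cone_proper _ _ := archCone_proper hS hT
  cone_compatible n m X x hx := by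
    rw [← matrixConj_map_algebraMap (A := A)]
    exact archCone_matrixConj _ (matrixConj_smul _) hx
  order_unit n x hx := by
    obtain ⟨r, hr, h⟩ := exists_sub_mem_sumCone hx
    exact ⟨r, hr, sumCone_subset_archCone h⟩
  archimedean n x _ h r hr := by
    have := h (r / 2) (half_pos hr) (r / 2) (half_pos hr)
    rwa [unitMatrix, ← add_assoc, ← add_smul, ← Complex.ofReal_add, add_halves] at this

theorem operatorASystem (hS : IsFaithful A S) (hT : IsFaithful A T) :
    letI := operatorSystem hS hT
    OperatorASystem A (Amalgam A S T) :=
  letI := operatorSystem hS hT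
  { isScalarTower_op := inferInstance
    star_smul := fun a => mk_surjective.forall.2 fun x => by
      rw [← mk_smul_left, ← mk_star, ← mk_star, ← mk_smul_right]
      congr 1
      ext <;> simp [OperatorASystem.star_smul, Prod.star_def]
    smul_unit := fun a => by
      change a • inl A S T unit = op a • inl A S T unit
      rw [← inl_smul, ← inl_op_smul, OperatorASystem.smul_unit]
    cone_compatible := fun _ _ a _ hx => archCone_matrixConj a (matrixConj_smul a) hx }

theorem isMorphism_inl (hS : IsFaithful A S) (hT : IsFaithful A T) :
    letI := operatorSystem hS hT
    IsMorphism A (inl A S T) :=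
  letI := operatorSystem hS hT
  { unital := rfl
    completelyPositive := fun n x hx => sumCone_subset_archCone
      ⟨x, hx, 0, zero_mem_cone n, by ext; simp [comb]⟩
    bimodule := fun a b s => by rw [inl_op_smul, inl_smul] }

theorem isMorphism_inr (hS : IsFaithful A S) (hT : IsFaithful A T) :
    letI := operatorSystem hS hT
    IsMorphism A (inr A S T) :=
  letI := operatorSystem hS hT
  { unital := inl_unit.symm
    completelyPositive := fun n x hx => sumCone_subset_archCone
      ⟨0, zero_mem_cone n, x, hx, by ext; simp [comb]⟩
    bimodule := fun a b s => by rw [inr_op_smul, inr_smul] }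

variable {R : Type p} [OperatorSystem R] [Module A R] [Module Aᵐᵒᵖ R] [OperatorASystem A R]
  {ψ₁ : S →ₗ[ℂ] R} {ψ₂ : T →ₗ[ℂ] R}

/-- The map out of the amalgam induced by two morphisms. -/
def desc (h₁ : IsMorphism A ψ₁) (h₂ : IsMorphism A ψ₂) : Amalgam A S T →ₗ[ℂ] R where
  toFun := QuotientAddGroup.lift _ (ψ₁.toAddMonoidHom.coprod ψ₂.toAddMonoidHom) <| by
    rintro _ ⟨a, rfl⟩
    simp [h₁.map_ofAlgebra, h₂.map_ofAlgebra]
  map_add' x y := map_add _ x y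
  map_smul' z := mk_surjective.forall.2 fun x => by
    change ψ₁ (z • x.1) + ψ₂ (z • x.2) = z • (ψ₁ x.1 + ψ₂ x.2)
    simp

theorem desc_mk (h₁ : IsMorphism A ψ₁) (h₂ : IsMorphism A ψ₂) (x : S × T) :
    desc h₁ h₂ (mk A S T x) = ψ₁ x.1 + ψ₂ x.2 := rfl

theorem desc_inl (h₁ : IsMorphism A ψ₁) (h₂ : IsMorphism A ψ₂) (s : S) :
    desc h₁ h₂ (inl A S T s) = ψ₁ s :=
  (desc_mk h₁ h₂ (s, 0)).trans (by simp)

theorem desc_inr (h₁ : IsMorphism A ψ₁) (h₂ : IsMorphism A ψ₂) (t : T) :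
    desc h₁ h₂ (inr A S T t) = ψ₂ t :=
  (desc_mk h₁ h₂ (0, t)).trans (by simp)

theorem isMorphism_desc (hS : IsFaithful A S) (hT : IsFaithful A T)
    (h₁ : IsMorphism A ψ₁) (h₂ : IsMorphism A ψ₂) :
    letI := operatorSystem hS hT
    IsMorphism A (desc h₁ h₂) :=
  letI := operatorSystem hS hT
  { unital := (desc_inl h₁ h₂ _).trans h₁.unital
    -- Only `r e + x` has a positive decomposition; the Archimedean property of `R` removes `r`.
    completelyPositive := fun n x hx => mem_cone_of_forall_smul_add fun r hr => by
      obtain ⟨s, hs, t, ht, he⟩ := hx r hr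
      convert cone_add n _ (h₁.completelyPositive n s hs) _ (h₂.completelyPositive n t ht) using 1
      have := congrArg (fun y => y.map (desc h₁ h₂)) he
      ext i j
      replace this := congrFun (congrFun this i) j
      simp only [Matrix.map_apply, unitMatrix, comb, Matrix.add_apply, Matrix.smul_apply,
        map_add, map_smul, desc_inl, desc_inr] at this ⊢
      rw [← this]
      by_cases hij : i = j <;> simp [hij, desc_inl, h₁.unital]
    bimodule := fun a b => mk_surjective.forall.2 fun x => by
      rw [← mk_smul_left, ← mk_smul_right, desc_mk, desc_mk]
      simp [h₁.bimodule, h₂.bimodule] }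

theorem isCoproduct (hS : IsFaithful A S) (hT : IsFaithful A T) :
    letI := operatorSystem hS hT
    IsCoproduct A (inl A S T) (inr A S T) :=
  letI := operatorSystem hS hT
  { morphism_left := isMorphism_inl hS hT
    morphism_right := isMorphism_inr hS hT
    universal := fun R _ _ _ _ ψ₁ ψ₂ h₁ h₂ => by
      refine ⟨desc h₁ h₂, ⟨isMorphism_desc hS hT h₁ h₂, LinearMap.ext (desc_inl h₁ h₂),
        LinearMap.ext (desc_inr h₁ h₂)⟩, ?_⟩
      rintro Ψ ⟨-, rfl, rfl⟩
      ext x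
      obtain ⟨s, t, rfl⟩ := exists_eq_inl_add_inr x
      simp [desc_inl, desc_inr] }

/-- A pair `(s, 0)` in the kernel is `(a · e, -a · e)` with `a · e = 0` in `T`, so faithfulness of
the other summand is what matters. -/
theorem inl_injective (hT : IsFaithful A T) : Function.Injective (inl A S T) :=
  (injective_iff_map_eq_zero _).2 fun s hs => by
    obtain ⟨a, rfl, ha⟩ := inl_add_inr_eq_zero_iff.1
      ((congrArg (· + inr A S T 0) hs).trans (by simp))
    rw [(injective_iff_map_eq_zero _).1 hT.injective a (neg_eq_zero.1 ha.symm), map_zero]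

theorem inr_injective (hS : IsFaithful A S) : Function.Injective (inr A S T) :=
  (injective_iff_map_eq_zero _).2 fun t ht => by
    obtain ⟨a, ha, rfl⟩ := inl_add_inr_eq_zero_iff.1
      ((congrArg (inl A S T 0 + ·) ht).trans (by simp))
    rw [(injective_iff_map_eq_zero _).1 hS.injective a ha.symm, map_zero, neg_zero]

theorem exists_ofAlgebra_eq_of_inl_eq_inr {s : S} {t : T} (h : inl A S T s = inr A S T t) :
    ∃ a : A, ofAlgebra A S a = s := by
  obtain ⟨a, ha, -⟩ := inl_add_inr_eq_zero_iff (A := A) (s := s) (t := -t) |>.1 (by simp [h])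
  exact ⟨a, ha.symm⟩

end Amalgam

end AmalgamSystem

end OperatorASystem

open OperatorSystem OperatorASystem in
/-- The coproduct of two faithful operator `A`-systems exists, and for every coproduct `P` of them
the canonical maps `i₁`, `i₂` embed `S`, `T` into `P` so that `i₁(S) ∩ i₂(T)` is `A`, completely
order isomorphically via `a ↦ a · e = i₁(a · e) = i₂(a · e)`. -/
theorem corollary3p6 (A : Type w) [CStarAlgebra A]
    (S : Type u) [OperatorSystem S] [Module A S] [Module Aᵐᵒᵖ S] [OperatorASystem A S]
    (T : Type v) [OperatorSystem T] [Module A T] [Module Aᵐᵒᵖ T] [OperatorASystem A T]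
    (hS : IsFaithful A S) (hT : IsFaithful A T) :
    (∃ (P : Type (max u v)) (_ : OperatorSystem P) (_ : Module A P) (_ : Module Aᵐᵒᵖ P)
      (_ : OperatorASystem A P) (i₁ : S →ₗ[ℂ] P) (i₂ : T →ₗ[ℂ] P), IsCoproduct A i₁ i₂) ∧
    ∀ (P : Type (max u v)) [OperatorSystem P] [Module A P] [Module Aᵐᵒᵖ P] [OperatorASystem A P]
      (i₁ : S →ₗ[ℂ] P) (i₂ : T →ₗ[ℂ] P), IsCoproduct A i₁ i₂ →
      IsFaithful A P ∧
      IsCompleteOrderEmbedding cone cone i₁ ∧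
      IsCompleteOrderEmbedding cone cone i₂ ∧
      i₁ ∘ₗ ofAlgebra A S = ofAlgebra A P ∧
      i₂ ∘ₗ ofAlgebra A T = ofAlgebra A P ∧
      IsCompleteOrderEmbedding (cstarCone A) cone (ofAlgebra A P) ∧
      LinearMap.range i₁ ⊓ LinearMap.range i₂ = LinearMap.range (ofAlgebra A P) := by
  let _ := Amalgam.operatorSystem hS hT
  have := Amalgam.operatorASystem hS hT
  refine ⟨⟨Amalgam A S T, inferInstance, inferInstance, inferInstance, inferInstance,
    Amalgam.inl A S T, Amalgam.inr A S T, Amalgam.isCoproduct hS hT⟩, ?_⟩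
  intro P _ _ _ _ i₁ i₂ h
  -- The comparison map to the model suffices; neither its uniqueness nor its invertibility is
  -- needed.
  obtain ⟨Ψ, ⟨hΨ, hΨ₁, hΨ₂⟩, -⟩ := h.universal (Amalgam A S T) _ _
    (Amalgam.isMorphism_inl hS hT) (Amalgam.isMorphism_inr hS hT)
  have hi₁ : ∀ s, Ψ (i₁ s) = Amalgam.inl A S T s := LinearMap.congr_fun hΨ₁
  have hi₂ : ∀ t, Ψ (i₂ t) = Amalgam.inr A S T t := LinearMap.congr_fun hΨ₂
  have hj₁ : ∀ a, i₁ (ofAlgebra A S a) = ofAlgebra A P a := h.morphism_left.map_ofAlgebra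
  have hj₂ : ∀ a, i₂ (ofAlgebra A T a) = ofAlgebra A P a := h.morphism_right.map_ofAlgebra
  have hinj₁ : Function.Injective i₁ := fun s s' hs =>
    Amalgam.inl_injective hT (by rw [← hi₁, ← hi₁, hs])
  have hinj₂ : Function.Injective i₂ := fun t t' ht =>
    Amalgam.inr_injective hS (by rw [← hi₂, ← hi₂, ht])
  have hP : IsFaithful A P := fun a ha h0 => hS a ha <| hinj₁ <| by
    rw [map_zero]
    exact (hj₁ a).trans h0
  refine ⟨hP, ⟨hinj₁, fun n x => ⟨h.morphism_left.completelyPositive n x, fun hx => ?_⟩⟩,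
    ⟨hinj₂, fun n x => ⟨h.morphism_right.completelyPositive n x, fun hx => ?_⟩⟩,
    LinearMap.ext hj₁, LinearMap.ext hj₂, hP.isCompleteOrderEmbedding, ?_⟩
  · refine Amalgam.mem_cone_of_comb_zero_mem_archCone hT ?_
    have he : (x.map i₁).map Ψ = Amalgam.comb A x 0 := by
      ext i j
      simp [Amalgam.comb, hi₁]
    exact he ▸ hΨ.completelyPositive n _ hx
  · refine Amalgam.mem_cone_of_comb_zero_mem_archCone' hS ?_
    have he : (x.map i₂).map Ψ = Amalgam.comb A 0 x := by
      ext i j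
      simp [Amalgam.comb, hi₂]
    exact he ▸ hΨ.completelyPositive n _ hx
  · ext x
    constructor
    · rintro ⟨⟨s, rfl⟩, t, ht⟩
      obtain ⟨a, rfl⟩ := Amalgam.exists_ofAlgebra_eq_of_inl_eq_inr (A := A) (s := s) (t := t)
        (by rw [← hi₁, ← hi₂, ht])
      exact ⟨a, (hj₁ a).symm⟩
    · rintro ⟨a, rfl⟩
      exact ⟨⟨_, hj₁ a⟩, _, hj₂ a⟩
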